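/- Fix $K \geq 3$ and let $\mathcal{B}_{[1/4,3/4]}$ be the set of Bernoulli distributions $\mathrm{Ber}(p)$ with $p \in [1/4,3/4]$. A $K$-armed bandit problem in $\mathcal{B}_{[1/4,3/4]}$ is a $K$-tuple $\underline{\nu} = (\nu_1,\dots,\nu_K)$ of elements of $\mathcal{B}_{[1/4,3/4]}$, with expectations $\mu_1,\dots,\mu_K$. It is generic if $\mu_j \neq \mu_k$ for all $j \neq k$. We then let $a^\star(\underline{\nu})$ be its unique optimal arm, and $\Delta_a = \max_b \mu_b - \mu_a$. A strategy with budget $T$ has access to i.i.d. auxiliary randomizations $U_0, U_1, \dots, U_T$ (with an arbitrary fixed law on some measurable space). At each round $t = 1, \dots, T$ it picks an arm $A_t$ that is a measurable function of $(U_0, Y_1, U_1, \dots, Y_{t-1}, U_{t-1})$; then, given the past, the reward $Y_t$ is drawn from $\nu_{A_t}$ and $U_t$ is drawn independently of $Y_t$ and of the past. After round $T$ the strategy recommends an arm $I_T$ that is a measurable function of $(U_0, Y_1, U_1, \dots, Y_T, U_T)$. A sequence of strategies indexed by the budget $T$ is consistent on $\mathcal{B}_{[1/4,3/4]}$ if $\mathbb{P}_{\underline{\nu}}\bigl(I_T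 \neq a^\star(\underline{\nu})\bigr) \to 0$ as $T \to +\infty$ for every generic $K$-armed bandit problem $\underline{\nu}$ in $\mathcal{B}_{[1/4,3/4]}$. Then, for every consistent sequence of strategies on $\mathcal{B}_{[1/4,3/4]}$, there exist a strictly increasing sequence of budgets $(T_n)$ with values in $\{1,2,\dots\}$ and a generic $K$-armed bandit problem $\underline{\nu}$ in $\mathcal{B}_{[1/4,3/4]}$ such that $$\liminf_{n \to +\infty} \frac{1}{T_n} \ln \mathbb{P}_{\underline{\nu}}\bigl(I_{T_n} \neq a^\star(\underline{\nu})\bigr) \;\geq\; - \frac{30}{\ln K} \Biggl(\sum_{a \neq a^\star(\underline{\nu})} \frac{1}{\Delta_a^2}\Biggr)^{-1},$$ with the convention $\ln 0 = -\infty$. -/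

import Mathlib

open MeasureTheory ProbabilityTheory Filter

/-- Histories of a sequential interaction with auxiliary randomizations in `𝒰`: an element of
`History 𝒰 t` is a tuple `((U₀, (Y₁, U₁)), …, (Y_t, U_t))`, i.e. the list of the first `t` rewards
and of the auxiliary randomizations `U₀, …, U_t`. -/
def History (𝒰 : Type*) : ℕ → Type _
  | 0 => 𝒰
  | t + 1 => History 𝒰 t × (ℝ × 𝒰)

/-- The product σ-algebra on histories. -/
instance History.instMeasurableSpace (𝒰 : Type*) [m : MeasurableSpace 𝒰] :
    (t : ℕ) → MeasurableSpace (History 𝒰 t)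
  | 0 => m
  | t + 1 => @Prod.instMeasurableSpace (History 𝒰 t) (ℝ × 𝒰)
      (History.instMeasurableSpace 𝒰 t) inferInstance

/-- A (randomized) strategy for `K` arms with budget `T`. The arm pulled at round `t + 1 ≤ T` is
`A_{t+1} = sample t H_t`, where `H_t = (U₀, Y₁, U₁, …, Y_t, U_t)` (the maps `sample t` with `t ≥ T`
play no role), and the arm recommended after the `T` rounds is `I_T = recommend H_T`. -/
structure Strategy (𝒰 : Type*) [MeasurableSpace 𝒰] (K T : ℕ) where
  sample : (t : ℕ) → History 𝒰 t → Fin K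
  measurable_sample : ∀ t, Measurable (sample t)
  recommend : History 𝒰 T → Fin K
  measurable_recommend : Measurable recommend

namespace Strategy

variable {𝒰 : Type*} [MeasurableSpace 𝒰] {K T : ℕ}

/-- The conditional law of `(Y_{t+1}, U_{t+1})` given `H_t`: the reward is drawn from the
distribution of the arm `A_{t+1} = sample t H_t`, and the next auxiliary randomization is drawn
independently from `ρ`. -/
noncomputable def stepKernel (s : Strategy 𝒰 K T) (ρ : Measure 𝒰) (ν : Fin K → Measure ℝ)
    (t : ℕ) : Kernel (History 𝒰 t) (ℝ × 𝒰) :=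
  (Kernel.ofFunOfCountable fun a => (ν a).prod ρ).comap (s.sample t) (s.measurable_sample t)

/-- The law of the history `H_t` when the strategy `s` faces the bandit problem `ν` and the
auxiliary randomizations `U₀, U₁, …` are i.i.d. with law `ρ`. -/
noncomputable def historyLaw (s : Strategy 𝒰 K T) (ρ : Measure 𝒰) (ν : Fin K → Measure ℝ) :
    (t : ℕ) → Measure (History 𝒰 t)
  | 0 => ρ
  | t + 1 => (historyLaw s ρ ν t) ⊗ₘ (stepKernel s ρ ν t)

/-- The probability `ℙ_ν(I_T ≠ a)`. -/
noncomputable def probRecommendNe (s : Strategy 𝒰 K T) (ρ : Measure 𝒰) (ν : Fin K → Measure ℝ)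
    (a : Fin K) : ENNReal :=
  s.historyLaw ρ ν T {h | s.recommend h ≠ a}

end Strategy

/-- The expectation of a distribution over the real line. -/
noncomputable def expectation (ζ : Measure ℝ) : ℝ := ∫ x, x ∂ζ

/-- `ν` is a `K`-armed bandit problem in the model `𝒟`. -/
def IsProblemIn {K : ℕ} (𝒟 : Set (Measure ℝ)) (ν : Fin K → Measure ℝ) : Prop :=
  ∀ a, ν a ∈ 𝒟

/-- A bandit problem is generic if no two of its arms have the same expectation. -/
def IsGeneric {K : ℕ} (ν : Fin K → Measure ℝ) : Prop :=
  Function.Injective fun a => expectation (ν a)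

/-- `a` is the unique optimal arm of `ν`. -/
def IsBestArm {K : ℕ} (ν : Fin K → Measure ℝ) (a : Fin K) : Prop :=
  ∀ b, b ≠ a → expectation (ν b) < expectation (ν a)

/-- The gap `Δ_a = μ* - μ_a`, where `μ*` is the largest expectation in `ν`. -/
noncomputable def gap {K : ℕ} (ν : Fin K → Measure ℝ) (a : Fin K) : ℝ :=
  (⨆ b, expectation (ν b)) - expectation (ν a)

/-- A sequence of strategies, indexed by the budget, is consistent on the model `𝒟` if the
probability of misidentifying the optimal arm vanishes for every generic problem in `𝒟`. -/
def IsConsistent {𝒰 : Type*} [MeasurableSpace 𝒰] {K : ℕ} (𝒟 : Set (Measure ℝ))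
    (ρ : Measure 𝒰) (s : (T : ℕ) → Strategy 𝒰 K T) : Prop :=
  ∀ ν : Fin K → Measure ℝ, IsProblemIn 𝒟 ν → IsGeneric ν → ∀ a, IsBestArm ν a →
    Tendsto (fun T => (s T).probRecommendNe ρ ν a) atTop (nhds 0)

/-- The model of the Bernoulli distributions `Ber(p)` on `{0, 1} ⊆ ℝ` with `p ∈ [l, u]`. -/
def bernoulliModel (l u : ℝ) : Set (Measure ℝ) :=
  {ζ | ∃ p : unitInterval, l ≤ (p : ℝ) ∧ (p : ℝ) ≤ u ∧ ζ = bernoulliMeasure (1 : ℝ) 0 p}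

/-! Base problem: means 1/2 - aδ for the arms a = 0, …, K - 1, with optimal arm 0. Moving the mean
of an arm i ≥ 1 up to 1/2 + iδ makes i optimal, with gaps (i + b)δ, so the sum of inverse squared
gaps is at most (1 + i)/(iδ)². The divergence between the two laws of arm i is of order (iδ)².

Only T pulls are available, so for each T some arm i ≥ 1 receives, on average under the base
problem, at most a fraction w_i of them, with w_i proportional to 1/(1 + i); a single i serves
infinitely many T. Normalizing these weights costs a partial harmonic sum, whence the factor ln K.
By consistency at the base problem alone, arm 0 is recommended there with probability tending to 1.
A change of measure (`mul_exp_le_historyLaw_update`) shows that in the modified problem it is still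
recommended, now wrongly, with probability at least exp(-T(c + o(1))), where c, the divergence times
w_i, is of order (iδ)²/((1 + i) ln K), hence at most a constant over ln K times the inverse
complexity. -/

/-- A quantitative change of measure: if `∫ L ∂μ = 1`, the measure of an event under the
density `L` is bounded from below through the mean of `log L`. -/
theorem mul_exp_le_withDensity {Ω : Type*} [MeasurableSpace Ω] {μ : Measure Ω}
    [IsProbabilityMeasure μ] {L : Ω → ℝ} (hL : ∀ x, 0 < L x) (hLi : Integrable L μ)
    (hlog : Integrable (fun x => Real.log (L x)) μ) (h1 : ∫ x, L x ∂μ ≤ 1)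
    {E : Set Ω} (hE : MeasurableSet E) (hp : 0 < μ.real E) :
    ENNReal.ofReal (μ.real E * Real.exp ((∫ x, Real.log (L x) ∂μ - 1) / μ.real E)) ≤
      μ.withDensity (fun x => ENNReal.ofReal (L x)) E := by
  set p := μ.real E
  set c := (∫ x, Real.log (L x) ∂μ - 1) / p with hc
  -- Off E, log L ≤ L costs at most 1: this is the origin of the `- 1` in the exponent.
  have hcompl : ∫ x in Eᶜ, Real.log (L x) ∂μ ≤ 1 := by
    calc ∫ x in Eᶜ, Real.log (L x) ∂μ ≤ ∫ x in Eᶜ, L x ∂μ :=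
          setIntegral_mono hlog.integrableOn hLi.integrableOn
            fun x => (Real.log_le_sub_one_of_pos (hL x)).trans (by linarith)
      _ ≤ ∫ x, L x ∂μ := setIntegral_le_integral hLi (ae_of_all _ fun x => (hL x).le)
      _ ≤ 1 := h1
  have hlogE : c * p ≤ ∫ x in E, Real.log (L x) ∂μ := by
    rw [hc, div_mul_cancel₀ _ hp.ne', ← integral_add_compl hE hlog]
    linarith
  rw [withDensity_apply _ hE, ← ofReal_integral_eq_lintegral_ofReal hLi.integrableOn
    (ae_of_all _ fun x => (hL x).le)]
  apply ENNReal.ofReal_le_ofReal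
  -- Jensen on E through the tangent line of exp at c: L ≥ exp c * (1 - c + log L).
  calc p * Real.exp c ≤ Real.exp c * (p * (1 - c) + ∫ x in E, Real.log (L x) ∂μ) := by
        have := Real.exp_pos c
        nlinarith
    _ = ∫ x in E, Real.exp c * (1 - c + Real.log (L x)) ∂μ := by
        rw [integral_const_mul, integral_add (integrable_const _) hlog.integrableOn]
        simp [p]
    _ ≤ ∫ x in E, L x ∂μ := by
        refine setIntegral_mono (((integrable_const _).add hlog).const_mul _).integrableOn
          hLi.integrableOn fun x => ?_
        have h2 := Real.add_one_le_exp (Real.log (L x) - c)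
        have h3 : Real.exp c * Real.exp (Real.log (L x) - c) = L x := by
          rw [← Real.exp_add, add_sub_cancel, Real.exp_log (hL x)]
        have h4 := Real.exp_pos c
        change Real.exp c * (1 - c + Real.log (L x)) ≤ L x
        exact (mul_le_mul_of_nonneg_left (by linarith) h4.le).trans h3.le

/-! ### Likelihood ratios of histories -/

namespace Strategy

variable {𝒰 : Type*} [MeasurableSpace 𝒰] {K T : ℕ}

instance isMarkovKernel_stepKernel (s : Strategy 𝒰 K T) (ρ : Measure 𝒰)
    [IsProbabilityMeasure ρ] (ν : Fin K → Measure ℝ) [∀ a, IsProbabilityMeasure (ν a)] (t : ℕ) :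
    IsMarkovKernel (s.stepKernel ρ ν t) :=
  ⟨fun h => inferInstanceAs (IsProbabilityMeasure ((ν (s.sample t h)).prod ρ))⟩

theorem stepKernel_apply (s : Strategy 𝒰 K T) (ρ : Measure 𝒰) (ν : Fin K → Measure ℝ) (t : ℕ)
    (h : History 𝒰 t) : s.stepKernel ρ ν t h = (ν (s.sample t h)).prod ρ := rfl

instance isProbabilityMeasure_historyLaw (s : Strategy 𝒰 K T) (ρ : Measure 𝒰)
    [IsProbabilityMeasure ρ] (ν : Fin K → Measure ℝ) [∀ a, IsProbabilityMeasure (ν a)] :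
    ∀ t, IsProbabilityMeasure (s.historyLaw ρ ν t)
  | 0 => inferInstanceAs (IsProbabilityMeasure ρ)
  | t + 1 =>
    have := isProbabilityMeasure_historyLaw s ρ ν t
    inferInstanceAs (IsProbabilityMeasure (s.historyLaw ρ ν t ⊗ₘ s.stepKernel ρ ν t))

/-- The likelihood ratio of the history `H_t`, when the reward distribution of each arm `a` is
changed by the density `r a`. -/
noncomputable def likelihoodRatio (s : Strategy 𝒰 K T) (r : Fin K → ℝ → ℝ) :
    (t : ℕ) → History 𝒰 t → ℝ
  | 0 => fun _ => 1
  | t + 1 => fun h => likelihoodRatio s r t h.1 * r (s.sample t h.1) h.2.1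

theorem measurable_comp_sample (s : Strategy 𝒰 K T) {r : Fin K → ℝ → ℝ}
    (hr : ∀ a, Measurable (r a)) (t : ℕ) :
    Measurable fun h : History 𝒰 t × (ℝ × 𝒰) => r (s.sample t h.1) h.2.1 := by
  have h1 : Measurable fun x : Fin K × ℝ => r x.1 x.2 :=
    measurable_from_prod_countable_right hr
  exact h1.comp (((s.measurable_sample t).comp measurable_fst).prodMk
    (measurable_fst.comp measurable_snd))

theorem measurable_likelihoodRatio (s : Strategy 𝒰 K T) {r : Fin K → ℝ → ℝ}
    (hr : ∀ a, Measurable (r a)) : ∀ t, Measurable (s.likelihoodRatio r t)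
  | 0 => measurable_const
  | t + 1 => ((measurable_likelihoodRatio s hr t).comp measurable_fst).mul
      (s.measurable_comp_sample hr t)

theorem likelihoodRatio_pos (s : Strategy 𝒰 K T) {r : Fin K → ℝ → ℝ}
    (hr : ∀ a y, 0 < r a y) : ∀ t h, 0 < s.likelihoodRatio r t h
  | 0, _ => one_pos
  | t + 1, h => mul_pos (likelihoodRatio_pos s hr t h.1) (hr _ _)

theorem log_likelihoodRatio_succ (s : Strategy 𝒰 K T) {r : Fin K → ℝ → ℝ}
    (hr : ∀ a y, 0 < r a y) (t : ℕ) (h : History 𝒰 (t + 1)) :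
    Real.log (s.likelihoodRatio r (t + 1) h) =
      Real.log (s.likelihoodRatio r t h.1) + Real.log (r (s.sample t h.1) h.2.1) :=
  Real.log_mul (s.likelihoodRatio_pos hr t h.1).ne' (hr _ _).ne'

theorem abs_log_likelihoodRatio_le (s : Strategy 𝒰 K T) {r : Fin K → ℝ → ℝ} {M : ℝ}
    (hr : ∀ a y, 0 < r a y) (hM : ∀ a y, |Real.log (r a y)| ≤ M) :
    ∀ t h, |Real.log (s.likelihoodRatio r t h)| ≤ t * M
  | 0, _ => by simp [likelihoodRatio]
  | t + 1, h => by
    rw [s.log_likelihoodRatio_succ hr]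
    refine (abs_add_le _ _).trans ?_
    push_cast
    linarith [abs_log_likelihoodRatio_le s hr hM t h.1, hM (s.sample t h.1) h.2.1]

/-- Arm choices and auxiliary randomizations follow the same mechanism in both problems, so only the
reward densities survive in the ratio. -/
theorem historyLaw_eq_withDensity (s : Strategy 𝒰 K T) (ρ : Measure 𝒰) [IsProbabilityMeasure ρ]
    {ν ν' : Fin K → Measure ℝ} [∀ a, IsProbabilityMeasure (ν a)]
    [∀ a, IsProbabilityMeasure (ν' a)] {r : Fin K → ℝ → ℝ} (hr : ∀ a, Measurable (r a))
    (hpos : ∀ a y, 0 < r a y)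
    (hν : ∀ a, ν' a = (ν a).withDensity fun y => ENNReal.ofReal (r a y)) :
    ∀ t, s.historyLaw ρ ν' t =
      (s.historyLaw ρ ν t).withDensity fun h => ENNReal.ofReal (s.likelihoodRatio r t h)
  | 0 => by
    simp only [historyLaw, likelihoodRatio, ENNReal.ofReal_one]
    exact withDensity_one.symm
  | t + 1 => by
    have ih := historyLaw_eq_withDensity s ρ hr hpos hν t
    have hmL : Measurable fun h => ENNReal.ofReal (s.likelihoodRatio r t h) :=
      (s.measurable_likelihoodRatio hr t).ennreal_ofReal
    have hmL' : Measurable fun h : History 𝒰 t × (ℝ × 𝒰) =>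
        ENNReal.ofReal (s.likelihoodRatio r t h.1 * r (s.sample t h.1) h.2.1) :=
      (s.measurable_likelihoodRatio hr (t + 1)).ennreal_ofReal
    change s.historyLaw ρ ν' t ⊗ₘ s.stepKernel ρ ν' t =
      (s.historyLaw ρ ν t ⊗ₘ s.stepKernel ρ ν t).withDensity
      fun h => ENNReal.ofReal (s.likelihoodRatio r t h.1 * r (s.sample t h.1) h.2.1)
    refine Measure.ext_of_lintegral _ fun f hf => ?_
    rw [lintegral_withDensity_eq_lintegral_mul _ hmL' hf, Measure.lintegral_compProd hf,
      Measure.lintegral_compProd (hmL'.mul hf), ih,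
      lintegral_withDensity_eq_lintegral_mul _ hmL hf.lintegral_kernel_prod_right']
    refine lintegral_congr fun h => ?_
    have hmr : Measurable fun z : ℝ × 𝒰 => ENNReal.ofReal (r (s.sample t h) z.1) :=
      ((hr _).comp measurable_fst).ennreal_ofReal
    have hfh : Measurable fun z => f (h, z) := hf.comp measurable_prodMk_left
    simp only [Pi.mul_apply, stepKernel_apply]
    rw [hν, prod_withDensity_left ((hr _).ennreal_ofReal),
      lintegral_withDensity_eq_lintegral_mul _ hmr hfh,
      ← lintegral_const_mul _ (hmr.mul hfh)]
    refine lintegral_congr fun z => ?_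
    simp only [Pi.mul_apply]
    rw [ENNReal.ofReal_mul (s.likelihoodRatio_pos hpos t h).le, mul_assoc]

/-- The probability that arm `a` is pulled at round `t + 1`. -/
noncomputable def pullProb (s : Strategy 𝒰 K T) (ρ : Measure 𝒰) (ν : Fin K → Measure ℝ)
    (a : Fin K) (t : ℕ) : ℝ :=
  (s.historyLaw ρ ν t).real (s.sample t ⁻¹' {a})

theorem sum_pullProb (s : Strategy 𝒰 K T) (ρ : Measure 𝒰) [IsProbabilityMeasure ρ]
    (ν : Fin K → Measure ℝ) [∀ a, IsProbabilityMeasure (ν a)] (t : ℕ) :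
    ∑ a, s.pullProb ρ ν a t = 1 := by
  have h := (sum_measureReal_preimage_singleton (μ := s.historyLaw ρ ν t)
    (f := s.sample t) Finset.univ
    fun a _ => s.measurable_sample t (measurableSet_singleton a))
  simpa [pullProb] using h

/-- Divergence decomposition: given the past, each round contributes the mean log-density of the arm
pulled. Bounded log-densities make every term integrable. -/
theorem integral_log_likelihoodRatio (s : Strategy 𝒰 K T) (ρ : Measure 𝒰)
    [IsProbabilityMeasure ρ] {ν : Fin K → Measure ℝ} [∀ a, IsProbabilityMeasure (ν a)]
    {r : Fin K → ℝ → ℝ} {M : ℝ} (hr : ∀ a, Measurable (r a)) (hpos : ∀ a y, 0 < r a y)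
    (hM : ∀ a y, |Real.log (r a y)| ≤ M) (t : ℕ) :
    ∫ h, Real.log (s.likelihoodRatio r t h) ∂(s.historyLaw ρ ν t) =
      ∑ τ ∈ Finset.range t, ∑ a, s.pullProb ρ ν a τ * ∫ y, Real.log (r a y) ∂(ν a) := by
  induction t with
  | zero => simp [likelihoodRatio]
  | succ t ih =>
    have i1 : Integrable (fun h : History 𝒰 t × (ℝ × 𝒰) =>
        Real.log (s.likelihoodRatio r t h.1)) (s.historyLaw ρ ν t ⊗ₘ s.stepKernel ρ ν t) :=
      Integrable.of_bound
        ((s.measurable_likelihoodRatio hr t).comp measurable_fst).log.aestronglyMeasurable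
        (t * M) (ae_of_all _ fun h => s.abs_log_likelihoodRatio_le hpos hM t h.1)
    have i2 : Integrable (fun h : History 𝒰 t × (ℝ × 𝒰) =>
        Real.log (r (s.sample t h.1) h.2.1)) (s.historyLaw ρ ν t ⊗ₘ s.stepKernel ρ ν t) :=
      Integrable.of_bound (s.measurable_comp_sample hr t).log.aestronglyMeasurable
        M (ae_of_all _ fun h => hM _ _)
    simp_rw [s.log_likelihoodRatio_succ hpos]
    change ∫ h : History 𝒰 t × (ℝ × 𝒰), (Real.log (s.likelihoodRatio r t h.1) +
      Real.log (r (s.sample t h.1) h.2.1)) ∂(s.historyLaw ρ ν t ⊗ₘ s.stepKernel ρ ν t) = _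
    rw [integral_add i1 i2, Measure.integral_compProd i1, Measure.integral_compProd i2,
      Finset.sum_range_succ, ← ih]
    congr 1
    · simp
    · have h1 : ∀ h, ∫ z, Real.log (r (s.sample t h) z.1) ∂(s.stepKernel ρ ν t h) =
          ∑ a, (s.sample t ⁻¹' {a}).indicator (fun _ => ∫ y, Real.log (r a y) ∂(ν a)) h := by
        intro h
        rw [Finset.sum_eq_single (s.sample t h)]
        · rw [stepKernel_apply, integral_fun_fst (fun y => Real.log (r (s.sample t h) y))]
          simp
        · intro b _ hb
          simp [Ne.symm hb]
        · simp
      simp_rw [h1]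
      rw [integral_finsetSum _ fun a _ => (integrable_const _).indicator
        (s.measurable_sample t (measurableSet_singleton a))]
      refine Finset.sum_congr rfl fun a _ => ?_
      rw [integral_indicator_const _ (s.measurable_sample t (measurableSet_singleton a))]
      rfl

theorem mul_exp_le_historyLaw (s : Strategy 𝒰 K T) (ρ : Measure 𝒰) [IsProbabilityMeasure ρ]
    {ν ν' : Fin K → Measure ℝ} [∀ a, IsProbabilityMeasure (ν a)]
    [∀ a, IsProbabilityMeasure (ν' a)] {r : Fin K → ℝ → ℝ} {M : ℝ} (hr : ∀ a, Measurable (r a))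
    (hpos : ∀ a y, 0 < r a y) (hM : ∀ a y, |Real.log (r a y)| ≤ M)
    (hν : ∀ a, ν' a = (ν a).withDensity fun y => ENNReal.ofReal (r a y)) (t : ℕ)
    {E : Set (History 𝒰 t)} (hE : MeasurableSet E) {p : ℝ}
    (hpE : (s.historyLaw ρ ν t).real E = p) (hp : 0 < p) :
    ENNReal.ofReal (p * Real.exp ((∑ τ ∈ Finset.range t, ∑ a,
      s.pullProb ρ ν a τ * ∫ y, Real.log (r a y) ∂(ν a) - 1) / p)) ≤ s.historyLaw ρ ν' t E := by
  subst hpE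
  have hlaw := s.historyLaw_eq_withDensity ρ hr hpos hν t
  -- The ratio has mass one because the law under `ν'` is a probability; its integrability follows.
  have hmass : ∫⁻ h, ENNReal.ofReal (s.likelihoodRatio r t h) ∂(s.historyLaw ρ ν t) = 1 := by
    rw [← setLIntegral_univ, ← withDensity_apply _ MeasurableSet.univ, ← hlaw, measure_univ]
  have hnn : ∀ h, 0 ≤ s.likelihoodRatio r t h := fun h => (s.likelihoodRatio_pos hpos t h).le
  have hm := s.measurable_likelihoodRatio hr t
  have hi : Integrable (s.likelihoodRatio r t) (s.historyLaw ρ ν t) := by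
    refine ⟨hm.aestronglyMeasurable, ?_⟩
    rw [hasFiniteIntegral_iff_ofReal (ae_of_all _ hnn), hmass]
    exact ENNReal.one_lt_top
  have h1 : ∫ h, s.likelihoodRatio r t h ∂(s.historyLaw ρ ν t) = 1 := by
    rw [integral_eq_lintegral_of_nonneg_ae (ae_of_all _ hnn) hm.aestronglyMeasurable, hmass,
      ENNReal.toReal_one]
  rw [hlaw, ← s.integral_log_likelihoodRatio ρ hr hpos hM]
  exact mul_exp_le_withDensity (s.likelihoodRatio_pos hpos t) hi
    (Integrable.of_bound hm.log.aestronglyMeasurable (t * M)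
      (ae_of_all _ fun h => s.abs_log_likelihoodRatio_le hpos hM t h)) h1.le hE hp

end Strategy

/-! ### Bernoulli distributions -/

/-- The Bernoulli distribution on `{0, 1} ⊆ ℝ` with mean `x ∈ [0, 1]`. -/
noncomputable def bernoulliReal (x : ℝ) : Measure ℝ :=
  bernoulliMeasure (1 : ℝ) 0 (Set.projIcc 0 1 zero_le_one x)

instance (x : ℝ) : IsProbabilityMeasure (bernoulliReal x) :=
  inferInstanceAs (IsProbabilityMeasure (bernoulliMeasure _ _ _))

theorem integral_bernoulliReal {x : ℝ} (hx : x ∈ Set.Icc (0 : ℝ) 1) (f : ℝ → ℝ) :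
    ∫ y, f y ∂(bernoulliReal x) = x * f 1 + (1 - x) * f 0 := by
  rw [bernoulliReal, integral_bernoulliMeasure, Set.projIcc_of_mem _ hx]
  simp

theorem expectation_bernoulliReal {x : ℝ} (hx : x ∈ Set.Icc (0 : ℝ) 1) :
    expectation (bernoulliReal x) = x := by
  rw [expectation, integral_bernoulliReal hx (fun y => y)]
  ring

theorem bernoulliReal_mem_bernoulliModel {l u x : ℝ} (hx : x ∈ Set.Icc (0 : ℝ) 1) (hl : l ≤ x)
    (hu : x ≤ u) : bernoulliReal x ∈ bernoulliModel l u :=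
  ⟨⟨x, hx⟩, hl, hu, by rw [bernoulliReal, Set.projIcc_of_mem _ hx]⟩

/-- The density of `Ber(q)` with respect to `Ber(p)`. -/
noncomputable def bernoulliRatio (p q y : ℝ) : ℝ :=
  if y = 1 then q / p else (1 - q) / (1 - p)

theorem measurable_bernoulliRatio (p q : ℝ) : Measurable (bernoulliRatio p q) :=
  Measurable.ite (measurableSet_singleton 1) measurable_const measurable_const

theorem bernoulliRatio_pos {p q : ℝ} (hp : p ∈ Set.Ioo (0 : ℝ) 1) (hq : q ∈ Set.Ioo (0 : ℝ) 1)
    (y : ℝ) : 0 < bernoulliRatio p q y := by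
  unfold bernoulliRatio
  split_ifs
  · exact div_pos hq.1 hp.1
  · exact div_pos (sub_pos.2 hq.2) (sub_pos.2 hp.2)

theorem abs_log_bernoulliRatio_le (p q y : ℝ) :
    |Real.log (bernoulliRatio p q y)| ≤
      |Real.log (q / p)| + |Real.log ((1 - q) / (1 - p))| := by
  unfold bernoulliRatio
  split_ifs
  · exact le_add_of_nonneg_right (abs_nonneg _)
  · exact le_add_of_nonneg_left (abs_nonneg _)

theorem bernoulliReal_eq_withDensity {p q : ℝ} (hp : p ∈ Set.Ioo (0 : ℝ) 1)
    (hq : q ∈ Set.Ioo (0 : ℝ) 1) :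
    bernoulliReal q =
      (bernoulliReal p).withDensity fun y => ENNReal.ofReal (bernoulliRatio p q y) := by
  have hsmul : ∀ (x : NNReal) (μ : Measure ℝ), x • μ = ENNReal.ofReal x • μ := by
    intro x μ
    rw [ENNReal.ofReal_coe_nnreal]
    rfl
  have key : ∀ {x : ℝ} (hx : x ∈ Set.Ioo (0 : ℝ) 1), bernoulliReal x =
      ENNReal.ofReal x • Measure.dirac 1 + ENNReal.ofReal (1 - x) • Measure.dirac 0 := by
    intro x hx
    rw [bernoulliReal, Set.projIcc_of_mem _ ⟨hx.1.le, hx.2.le⟩, bernoulliMeasure_def,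
      hsmul, hsmul]
    rfl
  refine Measure.ext_of_lintegral _ fun f hf => ?_
  rw [lintegral_withDensity_eq_lintegral_mul _ (measurable_bernoulliRatio p q).ennreal_ofReal hf,
    key hp, key hq]
  have h1 := sub_pos.2 hp.2
  simp only [lintegral_add_measure, lintegral_smul_measure, lintegral_dirac, Pi.mul_apply,
    smul_eq_mul, bernoulliRatio, if_true, zero_ne_one, if_false]
  rw [← mul_assoc, ← mul_assoc, ← ENNReal.ofReal_mul hp.1.le, ← ENNReal.ofReal_mul h1.le,
    mul_div_cancel₀ _ hp.1.ne', mul_div_cancel₀ _ h1.ne']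

/-- The Kullback-Leibler divergence of Bernoulli distributions is at most their
`χ²`-divergence. -/
theorem neg_sq_div_le_integral_log_bernoulliRatio {p q : ℝ} (hp : p ∈ Set.Ioo (0 : ℝ) 1)
    (hq : q ∈ Set.Ioo (0 : ℝ) 1) :
    -((p - q) ^ 2 / (q * (1 - q))) ≤
      ∫ y, Real.log (bernoulliRatio p q y) ∂(bernoulliReal p) := by
  have hp1 := sub_pos.2 hp.2
  have hq1 := sub_pos.2 hq.2
  have hp0 := hp.1
  have hq0 := hq.1
  rw [integral_bernoulliReal ⟨hp.1.le, hp.2.le⟩ fun y => Real.log (bernoulliRatio p q y)]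
  simp only [bernoulliRatio, if_true, zero_ne_one, if_false]
  -- The bound log z ≥ 1 - 1/z, averaged under Ber(p), gives exactly minus the χ²-divergence.
  have h1 := Real.one_sub_inv_le_log_of_pos (div_pos hq0 hp0)
  have h2 := Real.one_sub_inv_le_log_of_pos (div_pos hq1 hp1)
  calc -((p - q) ^ 2 / (q * (1 - q)))
      = p * (1 - (q / p)⁻¹) + (1 - p) * (1 - ((1 - q) / (1 - p))⁻¹) := by
        field_simp
        ring
    _ ≤ _ := add_le_add (mul_le_mul_of_nonneg_left h1 hp0.le)
        (mul_le_mul_of_nonneg_left h2 hp1.le)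

/-! ### Gaps and elementary sums -/

theorem IsBestArm.gap_eq {K : ℕ} {ν : Fin K → Measure ℝ} {a : Fin K} (h : IsBestArm ν a)
    (b : Fin K) : gap ν b = expectation (ν a) - expectation (ν b) := by
  have : Nonempty (Fin K) := ⟨a⟩
  rw [gap, le_antisymm (ciSup_le fun c => ?_)
    (le_ciSup (f := fun b => expectation (ν b)) (Set.finite_range _).bddAbove a)]
  rcases eq_or_ne c a with rfl | hc
  · exact le_rfl
  · exact (h c hc).le

/-- The first term is 1/i²; the others telescope through 1/(k + 1)² ≤ 1/k - 1/(k + 1) and total at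
most 1/i. -/
theorem sum_range_one_div_add_sq_le {i : ℕ} (hi : 1 ≤ i) (n : ℕ) :
    ∑ b ∈ Finset.range n, 1 / ((i : ℝ) + b) ^ 2 ≤ (1 + i) / (i : ℝ) ^ 2 := by
  have hi0 : (0 : ℝ) < i := by exact_mod_cast hi
  have key : ∀ n : ℕ, ∑ b ∈ Finset.range (n + 1), 1 / ((i : ℝ) + b) ^ 2 ≤
      (1 + i) / (i : ℝ) ^ 2 - 1 / (i + n) := by
    intro n
    induction n with
    | zero =>
      refine le_of_eq ?_
      simp
      field_simp
      ring
    | succ n ih =>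
      rw [Finset.sum_range_succ]
      have h0 : (0 : ℝ) < i + n := by positivity
      have : 1 / ((i : ℝ) + (n + 1)) ^ 2 ≤ 1 / (i + n) - 1 / (i + (n + 1)) := by
        rw [div_sub_div _ _ h0.ne' (by positivity), div_le_div_iff₀ (by positivity)
          (by positivity)]
        nlinarith
      push_cast
      linarith
  refine (Finset.sum_le_sum_of_subset_of_nonneg (Finset.range_mono n.le_succ)
    fun _ _ _ => by positivity).trans ((key n).trans ?_)
  have : (0 : ℝ) ≤ 1 / (i + n) := by positivity
  linarith

/-- The harmonic sum is at least 1 + log((K + 1)/2), and ((K + 1)/2)⁵ ≥ K³ as soon as K ≥ 3 (32 ≥ 27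
at K = 3). -/
theorem log_le_sum_range_one_div {K : ℕ} (hK : 3 ≤ K) :
    1 + 3 / 5 * Real.log K ≤ ∑ i ∈ Finset.range K, 1 / (1 + (i : ℝ)) := by
  have key : ∀ n : ℕ, 1 + Real.log (((n : ℝ) + 2) / 2) ≤
      ∑ i ∈ Finset.range (n + 1), 1 / (1 + (i : ℝ)) := by
    intro n
    induction n with
    | zero => simp
    | succ n ih =>
      rw [Finset.sum_range_succ]
      have h0 : (0 : ℝ) < (n : ℝ) + 2 := by positivity
      have h1 : Real.log (((n : ℝ) + 1 + 2) / 2) ≤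
          Real.log (((n : ℝ) + 2) / 2) + 1 / (1 + ((n : ℝ) + 1)) := by
        have h2 := Real.log_le_sub_one_of_pos (x := ((n : ℝ) + 1 + 2) / (n + 2)) (by positivity)
        have h3 : ((n : ℝ) + 1 + 2) / 2 = (n + 2) / 2 * ((n + 1 + 2) / (n + 2)) := by field_simp
        rw [h3, Real.log_mul (by positivity) (by positivity)]
        have h4 : ((n : ℝ) + 1 + 2) / (n + 2) - 1 = 1 / (1 + ((n : ℝ) + 1)) := by
          field_simp
          ring
        linarith
      push_cast
      linarith
  obtain ⟨m, rfl⟩ := Nat.exists_eq_add_of_le hK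
  have h := key (m + 2)
  rw [show m + 2 + 1 = 3 + m by ring] at h
  refine le_trans ?_ h
  push_cast
  have h5 : 3 * Real.log (3 + (m : ℝ)) ≤ 5 * Real.log (((m : ℝ) + 2 + 2) / 2) := by
    have hm : (0 : ℝ) ≤ m := Nat.cast_nonneg m
    have e1 : 3 * Real.log (3 + (m : ℝ)) = Real.log ((3 + (m : ℝ)) ^ 3) := by
      rw [Real.log_pow]; norm_num
    have e2 : 5 * Real.log (((m : ℝ) + 2 + 2) / 2) =
        Real.log ((((m : ℝ) + 2 + 2) / 2) ^ 5) := by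
      rw [Real.log_pow]; norm_num
    rw [e1, e2]
    refine Real.log_le_log (by positivity) ?_
    have : (((m : ℝ) + 2 + 2) / 2) ^ 5 - (3 + (m : ℝ)) ^ 3 =
        (160 + 416 * m + 352 * m ^ 2 + 128 * m ^ 3 + 20 * m ^ 4 + m ^ 5) / 32 := by ring
    have : (0 : ℝ) ≤ (160 + 416 * m + 352 * m ^ 2 + 128 * m ^ 3 + 20 * m ^ 4 + m ^ 5) / 32 := by
      positivity
    linarith
  linarith

/-! ### Changing the mean of one arm -/

namespace Strategy

variable {𝒰 : Type*} [MeasurableSpace 𝒰] {K : ℕ}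

/-- Changing the mean of a single arm `i` of a Bernoulli bandit costs at most the expected number
of pulls of `i` times a divergence. -/
theorem mul_exp_le_historyLaw_update {T : ℕ} (s : Strategy 𝒰 K T) (ρ : Measure 𝒰)
    [IsProbabilityMeasure ρ] {m : Fin K → ℝ} {i : Fin K} {q : ℝ} (hm : m i ∈ Set.Ioo (0 : ℝ) 1)
    (hq : q ∈ Set.Ioo (0 : ℝ) 1) (t : ℕ) {E : Set (History 𝒰 t)} (hE : MeasurableSet E)
    {p : ℝ} (hpE : (s.historyLaw ρ (fun a => bernoulliReal (m a)) t).real E = p) (hp : 0 < p) :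
    ENNReal.ofReal (p * Real.exp ((-((m i - q) ^ 2 / (q * (1 - q)) *
      ∑ τ ∈ Finset.range t, s.pullProb ρ (fun a => bernoulliReal (m a)) i τ) - 1) / p)) ≤
      s.historyLaw ρ (fun a => bernoulliReal (Function.update m i q a)) t E := by
  classical
  set D := (m i - q) ^ 2 / (q * (1 - q)) with hD
  set r : Fin K → ℝ → ℝ := fun a y => if a = i then bernoulliRatio (m i) q y else 1 with hr
  have hri : r i = bernoulliRatio (m i) q := by
    ext y
    simp [hr]
  have hrne : ∀ a, a ≠ i → r a = fun _ => 1 := by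
    intro a ha
    ext y
    simp [hr, ha]
  have hmeas : ∀ a, Measurable (r a) := by
    intro a
    rcases eq_or_ne a i with rfl | ha
    · rw [hri]
      exact measurable_bernoulliRatio _ _
    · rw [hrne a ha]
      exact measurable_const
  have hpos : ∀ a y, 0 < r a y := by
    intro a y
    rcases eq_or_ne a i with rfl | ha
    · rw [hri]
      exact bernoulliRatio_pos hm hq y
    · rw [hrne a ha]
      exact one_pos
  have hM : ∀ a y, |Real.log (r a y)| ≤
      |Real.log (q / m i)| + |Real.log ((1 - q) / (1 - m i))| := by
    intro a y
    rcases eq_or_ne a i with rfl | ha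
    · rw [hri]
      exact abs_log_bernoulliRatio_le _ _ y
    · rw [hrne a ha]
      simp only [Real.log_one, abs_zero]
      positivity
  have hν : ∀ a, bernoulliReal (Function.update m i q a) =
      (bernoulliReal (m a)).withDensity fun y => ENNReal.ofReal (r a y) := by
    intro a
    rcases eq_or_ne a i with rfl | ha
    · rw [hri, Function.update_self]
      exact bernoulliReal_eq_withDensity hm hq
    · rw [hrne a ha, Function.update_of_ne ha]
      simp only [ENNReal.ofReal_one]
      exact withDensity_one.symm
  refine le_trans (ENNReal.ofReal_le_ofReal ?_)
    (s.mul_exp_le_historyLaw ρ hmeas hpos hM hν t hE hpE hp)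
  have hsum : -(D * ∑ τ ∈ Finset.range t, s.pullProb ρ (fun a => bernoulliReal (m a)) i τ) ≤
      ∑ τ ∈ Finset.range t, ∑ a, s.pullProb ρ (fun a => bernoulliReal (m a)) a τ *
        ∫ y, Real.log (r a y) ∂(bernoulliReal (m a)) := by
    rw [Finset.mul_sum, ← Finset.sum_neg_distrib]
    refine Finset.sum_le_sum fun τ _ => ?_
    rw [Finset.sum_eq_single i (fun a _ ha => by simp [hrne a ha]) (by simp), hri]
    have h1 := neg_sq_div_le_integral_log_bernoulliRatio hm hq
    have h2 : 0 ≤ s.pullProb ρ (fun a => bernoulliReal (m a)) i τ := measureReal_nonneg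
    rw [← hD] at h1
    nlinarith
  gcongr

theorem measurableSet_recommend_eq {T : ℕ} (s : Strategy 𝒰 K T) (a : Fin K) :
    MeasurableSet {h | s.recommend h = a} :=
  s.measurable_recommend (measurableSet_singleton a)

theorem tendsto_historyLaw_recommend_eq {s : (T : ℕ) → Strategy 𝒰 K T} {ρ : Measure 𝒰}
    [IsProbabilityMeasure ρ] {ν : Fin K → Measure ℝ} [∀ a, IsProbabilityMeasure (ν a)]
    {a : Fin K} (h : Tendsto (fun T => (s T).probRecommendNe ρ ν a) atTop (nhds 0)) :
    Tendsto (fun T => ((s T).historyLaw ρ ν T).real {h | (s T).recommend h = a}) atTop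
      (nhds 1) := by
  have h1 := (ENNReal.tendsto_toReal ENNReal.zero_ne_top).comp h
  have h2 := h1.const_sub 1
  rw [ENNReal.toReal_zero, sub_zero] at h2
  refine h2.congr fun T => ?_
  have h3 := probReal_compl_eq_one_sub (μ := (s T).historyLaw ρ ν T)
    ((s T).measurableSet_recommend_eq a)
  change 1 - ((s T).historyLaw ρ ν T).real {h | (s T).recommend h = a}ᶜ = _
  rw [h3]
  ring

/-- If the optimal arm `o` of a Bernoulli bandit is identified with probability tending to `1` and
arm `i` is pulled at most a fraction `w` of the time, then `o` is still recommended with a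
non-negligible probability when the mean of `i` is changed. -/
theorem eventually_le_log_probRecommendNe_update {s : (T : ℕ) → Strategy 𝒰 K T} {ρ : Measure 𝒰}
    [IsProbabilityMeasure ρ] {m : Fin K → ℝ} {o i : Fin K} (hoi : o ≠ i) {q w B : ℝ}
    (hm : m i ∈ Set.Ioo (0 : ℝ) 1) (hq : q ∈ Set.Ioo (0 : ℝ) 1)
    (h : Tendsto (fun T => (s T).probRecommendNe ρ (fun a => bernoulliReal (m a)) o) atTop
      (nhds 0))
    (hB : (m i - q) ^ 2 / (q * (1 - q)) * w < B) :
    ∀ᶠ T : ℕ in atTop, ∑ τ ∈ Finset.range T,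
        (s T).pullProb ρ (fun a => bernoulliReal (m a)) i τ ≤ w * T →
      ((-B : ℝ) : EReal) ≤ ((1 / (T : ℝ) : ℝ) : EReal) * ENNReal.log
        ((s T).probRecommendNe ρ (fun a => bernoulliReal (Function.update m i q a)) i) := by
  set D := (m i - q) ^ 2 / (q * (1 - q)) with hD
  have hD0 : 0 ≤ D := div_nonneg (sq_nonneg _) (mul_nonneg hq.1.le (sub_nonneg.2 hq.2.le))
  set p : ℕ → ℝ := fun T => ((s T).historyLaw ρ (fun a => bernoulliReal (m a)) T).real
    {h | (s T).recommend h = o} with hpdef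
  have hp : Tendsto p atTop (nhds 1) := tendsto_historyLaw_recommend_eq h
  have hT : Tendsto (fun T : ℕ => 1 / (T : ℝ)) atTop (nhds 0) := tendsto_one_div_atTop_nhds_zero_nat
  -- The rate given by the change of measure tends to -D * w since p T → 1; the strict inequality
  -- `hB` absorbs the error.
  have hlim : Tendsto (fun T : ℕ => 1 / (T : ℝ) * Real.log (p T) +
      (-(D * w) - 1 / (T : ℝ)) / p T) atTop (nhds (-(D * w))) := by
    have h1 := (hT.mul (hp.log one_ne_zero)).add
      ((hT.const_sub (-(D * w))).div hp one_ne_zero)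
    simpa using h1
  filter_upwards [hlim.eventually (lt_mem_nhds (neg_lt_neg hB)),
    hp.eventually (lt_mem_nhds one_pos), eventually_gt_atTop 0] with T hT1 hT2 hT3 hN
  have hT0 : (0 : ℝ) < T := by exact_mod_cast hT3
  set N := ∑ τ ∈ Finset.range T, (s T).pullProb ρ (fun a => bernoulliReal (m a)) i τ
  have h1 := (s T).mul_exp_le_historyLaw_update ρ hm hq T
    ((s T).measurableSet_recommend_eq o) (p := p T) rfl hT2
  rw [← hD] at h1
  -- Recommending o is an error in the modified problem, as o ≠ i.
  have h2 : ENNReal.ofReal (p T * Real.exp ((-(D * N) - 1) / p T)) ≤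
      (s T).probRecommendNe ρ (fun a => bernoulliReal (Function.update m i q a)) i :=
    h1.trans (measure_mono fun x hx => by
      simp only [Set.mem_ofPred_eq] at hx ⊢
      rwa [hx])
  have hx : 0 < p T * Real.exp ((-(D * N) - 1) / p T) := mul_pos hT2 (Real.exp_pos _)
  have h3 := ENNReal.log_le_log h2
  rw [ENNReal.log_ofReal_of_pos hx, Real.log_mul hT2.ne' (Real.exp_pos _).ne',
    Real.log_exp] at h3
  refine le_trans ?_ (mul_le_mul_of_nonneg_left h3 (EReal.coe_nonneg.2 (by positivity)))
  rw [← EReal.coe_mul, EReal.coe_le_coe_iff]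
  refine hT1.le.trans ?_
  rw [mul_add]
  gcongr
  calc (-(D * w) - 1 / (T : ℝ)) / p T = 1 / (T : ℝ) * ((-(D * (w * T)) - 1) / p T) := by
        field_simp
    _ ≤ _ := by gcongr

end Strategy

/-! ### Pigeonhole on the pulls -/

namespace Strategy

variable {𝒰 : Type*} [MeasurableSpace 𝒰] {K : ℕ}

theorem sum_erase_sum_pullProb_le {T : ℕ} (s : Strategy 𝒰 K T) (ρ : Measure 𝒰)
    [IsProbabilityMeasure ρ] (ν : Fin K → Measure ℝ) [∀ a, IsProbabilityMeasure (ν a)]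
    (o : Fin K) (t : ℕ) :
    ∑ i ∈ Finset.univ.erase o, ∑ τ ∈ Finset.range t, s.pullProb ρ ν i τ ≤ t := by
  calc ∑ i ∈ Finset.univ.erase o, ∑ τ ∈ Finset.range t, s.pullProb ρ ν i τ
      ≤ ∑ i, ∑ τ ∈ Finset.range t, s.pullProb ρ ν i τ :=
        Finset.sum_le_sum_of_subset_of_nonneg (Finset.erase_subset _ _)
          fun i _ _ => Finset.sum_nonneg fun τ _ => measureReal_nonneg
    _ = t := by
        rw [Finset.sum_comm]
        simp [sum_pullProb]

/-- Among weights of total mass one, some arm is pulled infinitely often (along the budgets) at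
most the corresponding fraction of the time. -/
theorem exists_frequently_sum_pullProb_le (s : (T : ℕ) → Strategy 𝒰 K T) (ρ : Measure 𝒰)
    [IsProbabilityMeasure ρ] (ν : Fin K → Measure ℝ) [∀ a, IsProbabilityMeasure (ν a)]
    (o : Fin K) (w : Fin K → ℝ) (hw : ∑ i ∈ Finset.univ.erase o, w i = 1) :
    ∃ i, i ≠ o ∧ ∃ᶠ T : ℕ in atTop,
      ∑ τ ∈ Finset.range T, (s T).pullProb ρ ν i τ ≤ w i * T := by
  -- Otherwise, as there are finitely many arms, at some T all arms i ≠ o exceed their share, and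
  -- their pulls total more than T.
  by_contra! hcon
  have h1 : ∀ᶠ T : ℕ in atTop, ∀ i, i ≠ o →
      w i * T < ∑ τ ∈ Finset.range T, (s T).pullProb ρ ν i τ := by
    rw [eventually_all]
    intro i
    by_cases hi : i = o
    · exact Eventually.of_forall fun T h => absurd hi h
    · exact (hcon i hi).mono fun T hT _ => hT
  obtain ⟨T, hT⟩ := h1.exists
  have hne : (Finset.univ.erase o).Nonempty := by
    by_contra hemp
    rw [Finset.not_nonempty_iff_eq_empty] at hemp
    simp [hemp] at hw
  have h2 := Finset.sum_lt_sum_of_nonempty hne fun i hi => hT i (Finset.ne_of_mem_erase hi)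
  rw [← Finset.sum_mul, hw, one_mul] at h2
  exact absurd ((s T).sum_erase_sum_pullProb_le ρ ν o T) (not_le.2 h2)

end Strategy

/-- In a bandit problem whose gaps are `(i + b) δ` for the arms `b ≠ i`, the complexity is at most
`(1 + i) / (i δ)²`. -/
theorem sum_one_div_sq_le {K i : ℕ} (hi : 1 ≤ i) {δ : ℝ} (s : Finset (Fin K)) :
    ∑ b ∈ s, 1 / (((i : ℝ) + (b : ℕ)) * δ) ^ 2 ≤ (1 + i) / ((i : ℝ) * δ) ^ 2 := by
  calc ∑ b ∈ s, 1 / (((i : ℝ) + (b : ℕ)) * δ) ^ 2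
      -- The sum may run over all arms: the extra terms are nonnegative.
      ≤ ∑ b : Fin K, 1 / (((i : ℝ) + (b : ℕ)) * δ) ^ 2 :=
        Finset.sum_le_sum_of_subset_of_nonneg (Finset.subset_univ _)
          fun _ _ _ => by positivity
    _ = (∑ b ∈ Finset.range K, 1 / ((i : ℝ) + b) ^ 2) * (1 / δ ^ 2) := by
        rw [Fin.sum_univ_eq_sum_range (fun b => 1 / (((i : ℝ) + b) * δ) ^ 2), Finset.sum_mul]
        refine Finset.sum_congr rfl fun b _ => ?_
        rw [mul_pow, one_div_mul_one_div]
    _ ≤ (1 + i) / (i : ℝ) ^ 2 * (1 / δ ^ 2) :=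
        mul_le_mul_of_nonneg_right (sum_range_one_div_add_sq_le hi K) (by positivity)
    _ = _ := by
        rw [mul_pow, div_mul_div_comm, mul_one]

/-! ### The lower bound -/

theorem mainTheorem11 (K : ℕ) (hK : 3 ≤ K)
    {𝒰 : Type*} [MeasurableSpace 𝒰] (ρ : Measure 𝒰) [IsProbabilityMeasure ρ]
    (s : (T : ℕ) → Strategy 𝒰 K T)
    (hs : IsConsistent (bernoulliModel (1 / 4) (3 / 4)) ρ s) :
    ∃ B : ℕ → ℕ, StrictMono B ∧ (∀ n, 1 ≤ B n) ∧
      ∃ ν : Fin K → Measure ℝ,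
        IsProblemIn (bernoulliModel (1 / 4) (3 / 4)) ν ∧ IsGeneric ν ∧
        ∃ a : Fin K, IsBestArm ν a ∧
          ((-(30 / Real.log K) * (∑ b ∈ Finset.univ.erase a, 1 / (gap ν b) ^ 2)⁻¹ : ℝ) : EReal) ≤
            liminf (fun n => ((1 / (B n : ℝ) : ℝ) : EReal) *
              ENNReal.log ((s (B n)).probRecommendNe ρ ν a)) atTop := by
  have hK0 : (0 : ℝ) < K := by exact_mod_cast (by omega : 0 < K)
  -- With K * δ = 1/10, all means used lie in [2/5, 3/5].
  obtain ⟨δ, hδ, hδK⟩ : ∃ δ : ℝ, 0 < δ ∧ K * δ = 1 / 10 :=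
    ⟨1 / (10 * K), by positivity, by field_simp⟩
  have hsmall : ∀ a : Fin K, ((a : ℕ) : ℝ) * δ ≤ 1 / 10 := fun a => by
    rw [← hδK]
    exact mul_le_mul_of_nonneg_right (by exact_mod_cast a.2.le) hδ.le
  have hnn : ∀ a : Fin K, 0 ≤ ((a : ℕ) : ℝ) * δ := fun a => by positivity
  let o : Fin K := ⟨0, by omega⟩
  have ho : ∀ {a : Fin K}, a ≠ o → 1 ≤ (a : ℕ) := fun {a} ha =>
    Nat.one_le_iff_ne_zero.2 fun h => ha (Fin.ext h)
  let m : Fin K → ℝ := fun a => 1 / 2 - ((a : ℕ) : ℝ) * δ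
  have hma : ∀ a, m a = 1 / 2 - ((a : ℕ) : ℝ) * δ := fun a => rfl
  have hm : ∀ a, 2 / 5 ≤ m a ∧ m a ≤ 1 / 2 := fun a =>
    ⟨by linarith [hma a, hsmall a], by linarith [hma a, hnn a]⟩
  have hinj : Function.Injective m := fun a b hab => by
    have h1 : ((a : ℕ) : ℝ) * δ = ((b : ℕ) : ℝ) * δ := sub_right_injective hab
    exact Fin.ext (by exact_mod_cast mul_right_cancel₀ hδ.ne' h1)
  have hexp : ∀ {m' : Fin K → ℝ}, (∀ a, 2 / 5 ≤ m' a ∧ m' a ≤ 3 / 5) →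
      ∀ a, expectation (bernoulliReal (m' a)) = m' a := fun h a =>
    expectation_bernoulliReal ⟨by linarith [(h a).1], by linarith [(h a).2]⟩
  have hmodel : ∀ {m' : Fin K → ℝ}, (∀ a, 2 / 5 ≤ m' a ∧ m' a ≤ 3 / 5) →
      IsProblemIn (bernoulliModel (1 / 4) (3 / 4)) fun a => bernoulliReal (m' a) := fun h a =>
    bernoulliReal_mem_bernoulliModel ⟨by linarith [(h a).1], by linarith [(h a).2]⟩
      (by linarith [(h a).1]) (by linarith [(h a).2])
  have hgeneric : ∀ {m' : Fin K → ℝ}, (∀ a, 2 / 5 ≤ m' a ∧ m' a ≤ 3 / 5) →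
      Function.Injective m' → IsGeneric fun a => bernoulliReal (m' a) := fun h hi => by
    simpa only [IsGeneric, hexp h] using hi
  have hm' : ∀ a, 2 / 5 ≤ m a ∧ m a ≤ 3 / 5 := fun a => ⟨(hm a).1, by linarith [(hm a).2]⟩
  have hbase := hs (fun a => bernoulliReal (m a)) (hmodel hm') (hgeneric hm' hinj) o
    fun b hb => by
      have hb1 : (0 : ℝ) < ((b : ℕ) : ℝ) := by exact_mod_cast ho hb
      have hmo : m o = 1 / 2 := by simp [m, o]
      change expectation (bernoulliReal (m b)) < expectation (bernoulliReal (m o))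
      rw [hexp hm', hexp hm', hmo, hma]
      linarith [mul_pos hb1 hδ]
  set S := ∑ i ∈ Finset.univ.erase o, 1 / (1 + ((i : ℕ) : ℝ)) with hSdef
  have hlog : 0 < Real.log K := Real.log_pos (by exact_mod_cast (by omega : 1 < K))
  have hS : 3 / 5 * Real.log K ≤ S := by
    have h1 := log_le_sum_range_one_div hK
    rw [← Fin.sum_univ_eq_sum_range (fun i => 1 / (1 + (i : ℝ))),
      ← Finset.add_sum_erase _ _ (Finset.mem_univ o)] at h1
    simp only [o, Nat.cast_zero, add_zero, div_one] at h1
    exact le_of_add_le_add_left h1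
  have hS0 : 0 < S := lt_of_lt_of_le (by positivity) hS
  -- The weights mirror the factor 1 + i in the complexity bound `hHle`, so that i cancels in the
  -- final comparison.
  obtain ⟨i, hio, hfreq⟩ := Strategy.exists_frequently_sum_pullProb_le s ρ
    (fun a => bernoulliReal (m a)) o (fun i => 1 / (1 + ((i : ℕ) : ℝ)) / S)
    (by rw [← Finset.sum_div, ← hSdef, div_self hS0.ne'])
  have hi1 := ho hio
  have hi0 : (0 : ℝ) < ((i : ℕ) : ℝ) := by exact_mod_cast hi1
  set x := ((i : ℕ) : ℝ) * δ with hx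
  have hx0 : 0 < x := mul_pos hi0 hδ
  have hx1 : x ≤ 1 / 10 := hsmall i
  -- Reflecting the mean of i about 1/2 keeps all means distinct and shifts it by 2 * x only.
  set m₁ := Function.update m i (1 / 2 + x) with hm₁
  have hm₁i : m₁ i = 1 / 2 + x := Function.update_self ..
  have hm₁ne : ∀ {b}, b ≠ i → m₁ b = 1 / 2 - ((b : ℕ) : ℝ) * δ := fun hb =>
    Function.update_of_ne hb ..
  have hm₁' : ∀ a, 2 / 5 ≤ m₁ a ∧ m₁ a ≤ 3 / 5 := fun a => by
    rcases eq_or_ne a i with rfl | ha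
    · rw [hm₁i]
      constructor <;> linarith
    · rw [hm₁ne ha]
      exact hm' a
  have hlt : ∀ {b}, b ≠ i → m₁ b < m₁ i := fun {b} hb => by
    rw [hm₁i, hm₁ne hb]
    linarith [hnn b]
  have hinj₁ : Function.Injective m₁ := fun a b hab => by
    by_cases ha : a = i
    · by_cases hb : b = i
      · rw [ha, hb]
      · exact absurd (ha ▸ hab) (hlt hb).ne'
    · by_cases hb : b = i
      · exact absurd (hb ▸ hab) (hlt ha).ne
      · rw [hm₁ne ha, hm₁ne hb] at hab
        exact hinj hab
  have hbest : IsBestArm (fun a => bernoulliReal (m₁ a)) i := fun b hb => by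
    simpa only [hexp hm₁'] using hlt hb
  set H := ∑ b ∈ Finset.univ.erase i, 1 / (gap (fun a => bernoulliReal (m₁ a)) b) ^ 2 with hH
  have hgap : ∀ {b}, b ≠ i → gap (fun a => bernoulliReal (m₁ a)) b =
      (((i : ℕ) : ℝ) + ((b : ℕ) : ℝ)) * δ := fun {b} hb => by
    rw [hbest.gap_eq, hexp hm₁', hexp hm₁', hm₁i, hm₁ne hb]
    ring
  have hH' : H = ∑ b ∈ Finset.univ.erase i, 1 / ((((i : ℕ) : ℝ) + ((b : ℕ) : ℝ)) * δ) ^ 2 :=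
    Finset.sum_congr rfl fun b hb => by rw [hgap (Finset.ne_of_mem_erase hb)]
  have hHle : H ≤ (1 + ((i : ℕ) : ℝ)) / x ^ 2 := hH' ▸ sum_one_div_sq_le hi1 _
  have hH0 : 0 < H := by
    rw [hH']
    exact Finset.sum_pos (fun b _ => by positivity)
      ⟨o, Finset.mem_erase.2 ⟨hio.symm, Finset.mem_univ o⟩⟩
  have hB : (m i - (1 / 2 + x)) ^ 2 / ((1 / 2 + x) * (1 - (1 / 2 + x))) *
      (1 / (1 + ((i : ℕ) : ℝ)) / S) < 30 / Real.log K * H⁻¹ := by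
    have h1 : (m i - (1 / 2 + x)) ^ 2 = 4 * x ^ 2 := by
      simp only [m, ← hx]
      ring
    -- The product is 1/4 - x², and x ≤ 1/10.
    have h2 : 6 / 25 ≤ (1 / 2 + x) * (1 - (1 / 2 + x)) := by nlinarith
    have h3 : x ^ 2 / (1 + ((i : ℕ) : ℝ)) ≤ H⁻¹ := by
      rw [← inv_div]
      exact inv_anti₀ hH0 hHle
    rw [h1]
    -- The constant is 4 · (25/6) · (5/3) = 250/9 < 30.
    calc 4 * x ^ 2 / ((1 / 2 + x) * (1 - (1 / 2 + x))) * (1 / (1 + ((i : ℕ) : ℝ)) / S)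
        ≤ 4 * x ^ 2 / (6 / 25) * (1 / (1 + ((i : ℕ) : ℝ)) / (3 / 5 * Real.log K)) := by gcongr
      _ = 250 / 9 / Real.log K * (x ^ 2 / (1 + ((i : ℕ) : ℝ))) := by
          field_simp
          norm_num
      _ < 30 / Real.log K * (x ^ 2 / (1 + ((i : ℕ) : ℝ))) := by
          gcongr
          norm_num
      _ ≤ 30 / Real.log K * H⁻¹ := by gcongr
  have hev := Strategy.eventually_le_log_probRecommendNe_update (s := s) (ρ := ρ) (m := m)
    (o := o) hio.symm ⟨by linarith [(hm i).1], by linarith [(hm i).2]⟩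
    ⟨by linarith, by linarith⟩ hbase hB
  -- The budgets are the infinitely many T at which arm i is pulled rarely enough.
  obtain ⟨φ, hφ, hφP⟩ := extraction_of_frequently_atTop
    (hfreq.and_eventually (hev.and (eventually_ge_atTop 1)))
  refine ⟨φ, hφ, fun n => (hφP n).2.2, fun a => bernoulliReal (m₁ a), hmodel hm₁',
    hgeneric hm₁' hinj₁, i, hbest, ?_⟩
  rw [← hH, neg_mul]
  exact le_liminf_of_le (by isBoundedDefault)
    (Eventually.of_forall fun n => (hφP n).2.1 (hφP n).1)
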